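/- Let $d\ge 1$ (number of features) and $p\ge 0$ (maximal lag). For every feature $j\in\{1,\dots,d\}$ let $\mathsf{pa}(j)\subseteq\{0,\dots,p\}\times\{1,\dots,d\}$ be its parent set, where $(k,i)\in\mathsf{pa}(j)$ means that feature $i$ at time $t-k$ is a parent of feature $j$ at time $t$; the same-time graph ($i\to j$ iff $(0,i)\in\mathsf{pa}(j)$) is acyclic. Let $X^{(1)},X^{(2)},\dots,X^{(T)}$ be an $\mathbb R^d$-valued process with arbitrary initial snapshots $X^{(1)},\dots,X^{(p)}$ such that, for all $t\in\{p+1,\dots,T\}$ and all $j$, almost surely $$X^{(t)}_j=f_j\Big(\big(X^{(t-k)}_i\big)_{(k,i)\in\mathsf{pa}(j)}\Big)+z^{(t)}_j ,$$ where $z^{(t)}_j\sim\mathcal N(0,\sigma_j^2)$ with $\sigma_j^2>0$, the variables $z^{(t)}_1,\dots,z^{(t)}_d$ are mutually independent, and $z^{(t)}=(z^{(t)}_1,\dots,z^{(t)}_d)$ is independent of $(X^{(1)},\dots,X^{(t-1)})$. Assume that every link function $f_j$ is $C^\infty$ and that, for every parent in $\mathsf{pa}(j)$, the partial derivative of $f_j$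 with respect to that parent is not identically zero. Fix $t\in\{p+1,\dots,T\}$ and let $\bar X^{(t)}=(X^{(t)},X^{(t-1)},\dots,X^{(t-p)})$. Assume that $\bar X^{(t)}$ has an everywhere positive and differentiable probability density $\mathsf f^{(t)}$ on $\mathbb R^{(p+1)d}$. Let $l$ be a leaf at time $t$, i.e. $(0,l)\notin\mathsf{pa}(j)$ for all $j$. Let $\bar X^{(t)}_{\setminus\{l\}}$ be the vector $\bar X^{(t)}$ without the coordinate $X^{(t)}_l$, and let $\mathsf f^{(t)}_{\setminus\{l\}}$ be its density, obtained by integrating $\mathsf f^{(t)}$ over $x^{(t)}_l\in\mathbb R$. For a feature $j$ and a time $t'\in\{t,t-1,\dots,t-p\}$ with $(j,t')\ne(l,t)$ define the partial scores $$\mathsf s^{(t)}_{j,t'}(\bar x^{(t)})=\frac{\partial\log\mathsf f^{(t)}}{\partial x^{(t')}_j}(\bar x^{(t)}),\qquad \mathsf s^{(t)}_{j,t'}(\bar x^{(t)}_{\setminus\{l\}})=\frac{\partial\log\mathsf f^{(t)}_{\setminus\{l\}}}{\partial x^{(t')}_j}(\bar x^{(t)}_{\setminus\{l\}}),$$ and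 assume that the variance of $\mathsf s^{(t)}_{j,t'}(\bar X^{(t)}_{\setminus\{l\}})$ is finite. Then feature $j$ at time $t'$ is a parent of feature $l$ at time $t$, i.e. $(t-t',j)\in\mathsf{pa}(l)$, if and only if $$\mathrm{Var}\big(\mathsf s^{(t)}_{j,t'}(\bar X^{(t)})\big)>\mathrm{Var}\big(\mathsf s^{(t)}_{j,t'}(\bar X^{(t)}_{\setminus\{l\}})\big),$$ where the variance on the left is taken to be $+\infty$ if the score is not square-integrable. -/

import Mathlib

open MeasureTheory ProbabilityTheory
open scoped NNReal ENNReal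

noncomputable section

/-- The partial derivative `∂F/∂x_c` at `x` of a real function of the variables `x = (x_i)_{i ∈ ι}`. -/
def partialDeriv {ι : Type*} [DecidableEq ι] (F : (ι → ℝ) → ℝ) (c : ι) (x : ι → ℝ) : ℝ :=
  deriv (fun u : ℝ => F (Function.update x c u)) (x c)

/-- The partial score `∂ log g / ∂x_c` of a density `g`. -/
def partialScore {ι : Type*} [DecidableEq ι] (g : (ι → ℝ) → ℝ) (c : ι) (x : ι → ℝ) : ℝ :=
  partialDeriv (fun y => Real.log (g y)) c x

/-- The vector indexed by `ι` whose coordinate `a` is `u` and whose other coordinates are those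
of `y`. -/
def insertCoord {ι : Type*} [DecidableEq ι] (a : ι) (u : ℝ) (y : {c : ι // c ≠ a} → ℝ) : ι → ℝ :=
  fun c => if h : c = a then u else y ⟨c, h⟩

/-- The density of the remaining variables after the variable `a` has been marginalised out. -/
def marginalDensity {ι : Type*} [DecidableEq ι] (g : (ι → ℝ) → ℝ) (a : ι)
    (y : {c : ι // c ≠ a} → ℝ) : ℝ :=
  ∫ u : ℝ, g (insertCoord a u y)

/-- Nodes of the time-unrolled graph seen from the present time: `(k, i)` is the feature `i` at
lag `k ∈ {0, …, p}`, that is, at time `t - k`. -/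
abbrev LagNode (d p : ℕ) : Type := Fin (p + 1) × Fin d

/-- A structural vector autoregressive model with `d` features, maximal lag `p`, additive
Gaussian noise, and link functions that do not change in time. -/
structure SVARModel (d p : ℕ) where
  /-- `(k, i) ∈ pa j` says that feature `i` at time `t - k` is a parent of feature `j` at
  time `t`: the pairs with `k = 0` form the intra-snapshot graph, those with `k ≥ 1` the
  inter-snapshot graphs. -/
  pa : Fin d → Finset (LagNode d p)
  /-- The intra-snapshot graph has no directed cycle. -/
  acyclic : ∀ i, ¬ Relation.TransGen (fun i j : Fin d => ((0, i) : LagNode d p) ∈ pa j) i i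
  /-- The link function of feature `j`, a function of the values of the parents of `j`. -/
  link : (j : Fin d) → ((pa j → ℝ) → ℝ)
  /-- The variance of the noise of feature `j`. -/
  noiseVar : Fin d → ℝ≥0
  noiseVar_pos : ∀ j, 0 < noiseVar j

namespace SVARModel

variable {d p : ℕ}

/-- `l` is a leaf: at the same time step it is not a parent of any feature. -/
def IsLeaf (M : SVARModel d p) (l : Fin d) : Prop :=
  ∀ j, ((0, l) : LagNode d p) ∉ M.pa j

/-- Every link function is smooth, and none of its partial derivatives with respect to a parent
vanishes identically. -/
structure RegularLinks (M : SVARModel d p) : Prop where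
  smooth : ∀ j, ContDiff ℝ (⊤ : ℕ∞) (M.link j)
  partialDeriv_ne_zero : ∀ j, ∀ c : M.pa j, ∃ x, partialDeriv (M.link j) c x ≠ 0

/-- The process `X^{(1)}, …, X^{(T)}` is generated by the model `M` with the noise variables
`z`. The first `p` snapshots are arbitrary; at each time `s ∈ {p + 1, …, T}` every feature is its
link function evaluated at its parents, plus Gaussian noise that is independent across the features
and independent of all earlier snapshots. -/
structure Generates {Ω : Type*} [MeasurableSpace Ω] (M : SVARModel d p) (T : ℕ) (μ : Measure Ω)
    (X z : ℕ → Fin d → Ω → ℝ) : Prop where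
  measurable_process : ∀ s ∈ Set.Icc 1 T, ∀ j, Measurable (X s j)
  measurable_noise : ∀ s ∈ Set.Ioc p T, ∀ j, Measurable (z s j)
  noise_law : ∀ s ∈ Set.Ioc p T, ∀ j, μ.map (z s j) = gaussianReal 0 (M.noiseVar j)
  noise_indep : ∀ s ∈ Set.Ioc p T, iIndepFun (z s) μ
  noise_indep_past : ∀ s ∈ Set.Ioc p T,
    IndepFun (fun ω (j : Fin d) => z s j ω)
      (fun ω (r : Set.Ico 1 s) (i : Fin d) => X (r : ℕ) i ω) μ
  equation : ∀ s ∈ Set.Ioc p T, ∀ᵐ ω ∂μ, ∀ j,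
    X s j ω =
      M.link j (fun c : M.pa j => X (s - ((c : LagNode d p).1 : ℕ)) (c : LagNode d p).2 ω)
        + z s j ω

end SVARModel

/-- The vector `(X^{(t)}, …, X^{(t-p)})`. -/
def stackedVector {Ω : Type*} {d : ℕ} (p : ℕ) (X : ℕ → Fin d → Ω → ℝ) (t : ℕ) (ω : Ω) :
    LagNode d p → ℝ :=
  fun c => X (t - (c.1 : ℕ)) c.2 ω

/-- The vector `(X^{(t)}, …, X^{(t-p)})` without the coordinate `X_l^{(t)}`. -/
def stackedVectorWithout {Ω : Type*} {d : ℕ} (p : ℕ) (X : ℕ → Fin d → Ω → ℝ) (t : ℕ) (l : Fin d)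
    (ω : Ω) : {c : LagNode d p // c ≠ (0, l)} → ℝ :=
  fun c => stackedVector p X t ω c

end

/-!
Since `l` is a leaf, its noise `z_l` is independent of all the other coordinates of the stacked
vector, so the joint density factors as the marginal density of the other coordinates times the
Gaussian density at `x_l - f_l(parents)`. Taking logarithms and differentiating, the score of the
full vector is the score of the marginal minus `(log φ)'(z_l) · ∂f_l(parents)`, where `φ` is the
density of `z_l`. The factor `(log φ)'(z_l)` is centred and independent of everything else, so the
two terms are orthogonal: the variance strictly increases unless `∂f_l` vanishes almost surely.
The density being positive, `∂f_l` then vanishes Lebesgue almost everywhere, and hence identically.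
-/

section Coordinates

variable {ι : Type*} {a : ι}

/-- The vector `x` without its coordinate `a`; `insertCoord a` puts the coordinate back. -/
def eraseCoord (a : ι) (x : ι → ℝ) : {c : ι // c ≠ a} → ℝ :=
  fun c => x c

@[fun_prop]
theorem measurable_eraseCoord : Measurable (eraseCoord a) := by
  unfold eraseCoord; fun_prop

variable [DecidableEq ι]

theorem eraseCoord_update_coe (x : ι → ℝ) (c : {c : ι // c ≠ a}) (u : ℝ) :
    eraseCoord a (Function.update x c u) = Function.update (eraseCoord a x) c u :=
  Function.update_comp_eq_of_injective x Subtype.val_injective c u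

@[simp]
theorem insertCoord_self (u : ℝ) (y : {c : ι // c ≠ a} → ℝ) : insertCoord a u y a = u := by
  simp [insertCoord]

@[simp]
theorem insertCoord_coe (u : ℝ) (y : {c : ι // c ≠ a} → ℝ) (c : {c : ι // c ≠ a}) :
    insertCoord a u y c = y c := by
  simp [insertCoord, c.2]

@[simp]
theorem eraseCoord_insertCoord (u : ℝ) (y : {c : ι // c ≠ a} → ℝ) :
    eraseCoord a (insertCoord a u y) = y :=
  funext fun c => insertCoord_coe u y c

theorem insertCoord_eraseCoord (u : ℝ) (x : ι → ℝ) :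
    insertCoord a u (eraseCoord a x) = Function.update x a u := by
  funext c
  by_cases hc : c = a
  · subst hc; simp
  · simp [insertCoord, eraseCoord, hc]

@[simp]
theorem update_insertCoord (u w : ℝ) (y : {c : ι // c ≠ a} → ℝ) :
    Function.update (insertCoord a u y) a w = insertCoord a w y := by
  rw [← insertCoord_eraseCoord, eraseCoord_insertCoord]

@[fun_prop]
theorem measurable_insertCoord {E : Type*} [MeasurableSpace E] {f : E → ℝ}
    {y : E → {c : ι // c ≠ a} → ℝ} (hf : Measurable f) (hy : Measurable y) :
    Measurable fun e => insertCoord a (f e) (y e) := by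
  refine measurable_pi_lambda _ fun c => ?_
  by_cases hc : c = a
  · simpa [insertCoord, hc] using hf
  · simpa [insertCoord, hc] using measurable_pi_iff.1 hy _

@[fun_prop]
theorem continuous_insertCoord {E : Type*} [TopologicalSpace E] {f : E → ℝ}
    {y : E → {c : ι // c ≠ a} → ℝ} (hf : Continuous f) (hy : Continuous y) :
    Continuous fun e => insertCoord a (f e) (y e) := by
  refine continuous_pi fun c => ?_
  by_cases hc : c = a
  · simpa [insertCoord, hc] using hf
  · simpa [insertCoord, hc] using continuous_pi_iff.1 hy _

@[fun_prop]
theorem differentiable_insertCoord [Finite ι] {E : Type*} [NormedAddCommGroup E] [NormedSpace ℝ E]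
    {f : E → ℝ} {y : E → {c : ι // c ≠ a} → ℝ} (hf : Differentiable ℝ f)
    (hy : Differentiable ℝ y) : Differentiable ℝ fun e => insertCoord a (f e) (y e) := by
  have := Fintype.ofFinite ι
  refine differentiable_pi.2 fun c => ?_
  by_cases hc : c = a
  · simpa [insertCoord, hc] using hf
  · simpa [insertCoord, hc] using differentiable_pi.1 hy _

variable [Fintype ι]

theorem measurePreserving_insertCoord :
    MeasurePreserving (fun q : ({c : ι // c ≠ a} → ℝ) × ℝ => insertCoord a q.2 q.1) := by
  refine ⟨by fun_prop, (Measure.pi_eq fun s hs => ?_).symm⟩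
  have hpre : (fun q : ({c : ι // c ≠ a} → ℝ) × ℝ => insertCoord a q.2 q.1) ⁻¹' Set.univ.pi s
      = (Set.univ.pi fun c : {c : ι // c ≠ a} => s c) ×ˢ s a := by
    ext ⟨y, u⟩
    simp only [Set.mem_preimage, Set.mem_univ_pi, Set.mem_prod]
    refine ⟨fun h => ⟨fun c => by simpa using h c, by simpa using h a⟩, fun h c => ?_⟩
    by_cases hc : c = a
    · subst hc; simpa using h.2
    · simpa [insertCoord, hc] using h.1 ⟨c, hc⟩
  rw [Measure.map_apply (by fun_prop) (MeasurableSet.univ_pi hs), hpre, Measure.volume_eq_prod,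
    Measure.prod_prod, volume_pi_pi, mul_comm,
    Fintype.prod_eq_mul_prod_subtype_ne (fun c => volume (s c)) a]

theorem lintegral_eq_lintegral_lintegral_insertCoord (a : ι) {f : (ι → ℝ) → ℝ≥0∞}
    (hf : Measurable f) : ∫⁻ x, f x = ∫⁻ y, ∫⁻ u, f (insertCoord a u y) := by
  rw [← measurePreserving_insertCoord (a := a).lintegral_comp hf, Measure.volume_eq_prod,
    lintegral_prod _ (by fun_prop)]

theorem ae_ae_insertCoord_of_ae (a : ι) {P : (ι → ℝ) → Prop} (hP : ∀ᵐ x, P x) :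
    ∀ᵐ y, ∀ᵐ u, P (insertCoord a u y) :=
  Measure.ae_ae_of_ae_prod (measurePreserving_insertCoord.quasiMeasurePreserving.ae hP)

theorem map_eraseCoord_withDensity (a : ι) {f : (ι → ℝ) → ℝ≥0∞} (hf : Measurable f) :
    (volume.withDensity f).map (eraseCoord a)
      = volume.withDensity fun y => ∫⁻ u, f (insertCoord a u y) := by
  refine Measure.ext_of_lintegral _ fun k hk => ?_
  have hkE : Measurable fun x => k (eraseCoord a x) := by fun_prop
  rw [lintegral_map hk measurable_eraseCoord, lintegral_withDensity_eq_lintegral_mul _ hf hkE,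
    lintegral_eq_lintegral_lintegral_insertCoord a (hf.mul hkE),
    lintegral_withDensity_eq_lintegral_mul _ (by fun_prop) hk]
  simp only [Pi.mul_apply, eraseCoord_insertCoord]
  exact lintegral_congr fun y => lintegral_mul_const _ (by fun_prop)

end Coordinates

section PartialDerivative

theorem eq_of_hasDerivAt_of_ae_eq_zero {f f' : ℝ → ℝ} (hf : ∀ u, HasDerivAt f (f' u) u)
    (hf' : f' =ᵐ[volume] 0) (u w : ℝ) : f u = f w := by
  have hint : IntervalIntegrable f' volume w u := intervalIntegrable_const.congr_ae
    (ae_restrict_of_ae hf'.symm)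
  have hFTC := intervalIntegral.integral_eq_sub_of_hasDerivAt (fun u _ => hf u) hint
  rw [intervalIntegral.integral_congr_ae (hf'.mono fun _ h _ => h)] at hFTC
  simpa [sub_eq_zero, eq_comm] using hFTC

theorem partialDeriv_comp_of_injective {ι κ : Type*} [DecidableEq ι] [DecidableEq κ]
    (F : (κ → ℝ) → ℝ) {e : κ → ι} (he : e.Injective) (b : κ) (x : ι → ℝ) :
    partialDeriv (fun y => F (y ∘ e)) (e b) x = partialDeriv F b (x ∘ e) := by
  simp only [partialDeriv, Function.update_comp_eq_of_injective x he, Function.comp_apply]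

theorem partialDeriv_comp_of_notMem_range {ι κ : Type*} [DecidableEq ι]
    (F : (κ → ℝ) → ℝ) {e : κ → ι} {c : ι} (hc : c ∉ Set.range e) (x : ι → ℝ) :
    partialDeriv (fun y => F (y ∘ e)) c x = 0 := by
  simp only [partialDeriv,
    Function.update_comp_eq_of_forall_ne x _ fun b hb => hc ⟨b, hb⟩, deriv_const]

variable {ι : Type*} [DecidableEq ι] {F : (ι → ℝ) → ℝ}

section Finite

variable [Finite ι]

theorem hasDerivAt_comp_update (c : ι) (x : ι → ℝ) (u : ℝ)
    (hF : DifferentiableAt ℝ F (Function.update x c u)) :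
    HasDerivAt (fun w => F (Function.update x c w)) (fderiv ℝ F (Function.update x c u)
      (Pi.single c 1)) u := by
  have := Fintype.ofFinite ι
  exact hF.hasFDerivAt.comp_hasDerivAt u (hasDerivAt_update x c u)

theorem partialDeriv_eq_fderiv (c : ι) {x : ι → ℝ} (hF : DifferentiableAt ℝ F x) :
    partialDeriv F c x = fderiv ℝ F x (Pi.single c 1) := by
  simpa [partialDeriv] using (hasDerivAt_comp_update c x (x c) (by simpa using hF)).deriv

theorem hasDerivAt_partialDeriv (c : ι) (x : ι → ℝ) (u : ℝ)
    (hF : DifferentiableAt ℝ F (Function.update x c u)) :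
    HasDerivAt (fun w => F (Function.update x c w)) (partialDeriv F c (Function.update x c u)) u :=
  partialDeriv_eq_fderiv c hF ▸ hasDerivAt_comp_update c x u hF

theorem measurable_partialDeriv (hF : Differentiable ℝ F) (c : ι) :
    Measurable (partialDeriv F c) := by
  have := Fintype.ofFinite ι
  rw [show partialDeriv F c = _ from funext fun x => partialDeriv_eq_fderiv c (hF x)]
  exact measurable_fderiv_apply_const ℝ F _

end Finite

/-- By Fubini, `F` is constant on almost every line in the direction `c`, hence by continuity on
all of them. -/
theorem partialDeriv_eq_zero_of_ae [Fintype ι] (hF : Differentiable ℝ F) {c : ι}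
    (h0 : ∀ᵐ x, partialDeriv F c x = 0) (x : ι → ℝ) : partialDeriv F c x = 0 := by
  have hline : ∀ u w y, F (insertCoord c u y) = F (insertCoord c w y) := by
    intro u w
    refine congrFun ((Continuous.ae_eq_iff_eq volume (hF.continuous.comp (by fun_prop))
      (hF.continuous.comp (by fun_prop))).1 ?_)
    filter_upwards [ae_ae_insertCoord_of_ae c h0] with y hy
    refine eq_of_hasDerivAt_of_ae_eq_zero (f := fun u => F (insertCoord c u y)) (fun u => ?_) hy u w
    simpa using hasDerivAt_partialDeriv c (insertCoord c 0 y) u (hF _)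
  simp only [partialDeriv, ← insertCoord_eraseCoord, hline _ 0, deriv_const]

end PartialDerivative

section Independence

variable {Ω : Type*} [MeasurableSpace Ω] {μ : Measure Ω}

theorem indepFun_prodMk_right_of_prodMk_left {α β γ : Type*} [MeasurableSpace α]
    [MeasurableSpace β] [MeasurableSpace γ] [IsProbabilityMeasure μ]
    {A : Ω → α} {B : Ω → β} {C : Ω → γ} (hA : AEMeasurable A μ) (hB : AEMeasurable B μ)
    (hC : AEMeasurable C μ) (hAB : IndepFun A B μ)
    (hABC : IndepFun (fun ω => (A ω, B ω)) C μ) :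
    IndepFun A (fun ω => (B ω, C ω)) μ := by
  have hBC : IndepFun B C μ := hABC.comp measurable_snd measurable_id
  have := Measure.isProbabilityMeasure_map (μ := μ) hA
  have := Measure.isProbabilityMeasure_map (μ := μ) hB
  have := Measure.isProbabilityMeasure_map (μ := μ) hC
  rw [indepFun_iff_map_prod_eq_prod_map_map hA hB] at hAB
  rw [indepFun_iff_map_prod_eq_prod_map_map hB hC] at hBC
  rw [indepFun_iff_map_prod_eq_prod_map_map (hA.prodMk hB) hC] at hABC
  rw [indepFun_iff_map_prod_eq_prod_map_map hA (hB.prodMk hC), hBC,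
    ← Measure.prodAssoc_prod, ← hAB, ← hABC,
    AEMeasurable.map_map_of_aemeasurable MeasurableEquiv.prodAssoc.measurable.aemeasurable
      ((hA.prodMk hB).prodMk hC)]
  rfl

theorem not_mul_ae_eq_zero_of_indepFun {Z B : Ω → ℝ} (hind : IndepFun Z B μ)
    (hZ : ¬ Z =ᵐ[μ] 0) (hB : ¬ B =ᵐ[μ] 0) : ¬ Z * B =ᵐ[μ] 0 := by
  have hset : {ω | ¬ (Z * B) ω = 0} = Z ⁻¹' {0}ᶜ ∩ B ⁻¹' {0}ᶜ := by
    ext ω; simp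
  rw [Filter.EventuallyEq, ae_iff] at hZ hB ⊢
  simp only [Pi.zero_apply] at hZ hB ⊢
  rw [hset, hind.measure_inter_preimage_eq_mul _ _ (measurableSet_singleton 0).compl
    (measurableSet_singleton 0).compl]
  exact mul_ne_zero hZ hB

theorem evariance_lt_evariance_sub_of_integral_mul_eq_zero [IsProbabilityMeasure μ]
    {A W : Ω → ℝ} (hA : MemLp A 2 μ) (hW : AEStronglyMeasurable W μ) (hW0 : ¬ W =ᵐ[μ] 0)
    (hmean : μ[W] = 0) (horth : μ[A * W] = 0) :
    evariance A μ < evariance (A - W) μ := by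
  by_cases hAW : MemLp (A - W) 2 μ
  · have hWL : MemLp W 2 μ := by simpa using hA.sub hAW
    have hcov : cov[A, W; μ] = 0 := by rw [covariance_eq_sub hA hWL, horth, hmean]; simp
    have hvar : 0 < Var[W; μ] := (variance_nonneg W μ).lt_of_ne' fun h => hW0 <| by
      filter_upwards [ae_eq_integral_of_variance_eq_zero hWL h] with ω hω
      rw [hω, hmean, Pi.zero_apply]
    rw [← ofReal_variance hA, ← ofReal_variance hAW, variance_sub hA hWL, hcov]
    have := variance_nonneg A μ
    exact ENNReal.ofReal_lt_ofReal_iff'.2 ⟨by linarith, by linarith⟩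
  · rw [evariance_eq_top (hA.1.sub hW) hAW]
    exact evariance_lt_top hA

theorem evariance_lt_evariance_sub_mul_of_indepFun [IsProbabilityMeasure μ] {A B Z : Ω → ℝ}
    (hA : MemLp A 2 μ) (hB : AEMeasurable B μ) (hZ : AEMeasurable Z μ)
    (hB0 : ¬ B =ᵐ[μ] 0) (hZ0 : ¬ Z =ᵐ[μ] 0) (hmean : μ[Z] = 0)
    (hind : IndepFun Z (fun ω => (A ω, B ω)) μ) :
    evariance A μ < evariance (A - Z * B) μ := by
  have hZB : IndepFun Z B μ := hind.comp measurable_id measurable_snd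
  have hZAB : IndepFun Z (A * B) μ :=
    hind.comp measurable_id (measurable_fst.mul measurable_snd)
  refine evariance_lt_evariance_sub_of_integral_mul_eq_zero hA (hZ.mul hB).aestronglyMeasurable
    (not_mul_ae_eq_zero_of_indepFun hZB hZ0 hB0) ?_ ?_
  · rw [hZB.integral_mul_eq_mul_integral hZ.aestronglyMeasurable hB.aestronglyMeasurable, hmean,
      zero_mul]
  · rw [mul_left_comm, hZAB.integral_mul_eq_mul_integral hZ.aestronglyMeasurable
      (hA.1.mul hB.aestronglyMeasurable), hmean, zero_mul]

end Independence

section AdditiveNoise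

variable {Ω ι : Type*} [MeasurableSpace Ω] {μ : Measure Ω} {a : ι} {V : Ω → ι → ℝ} {Z : Ω → ℝ}
  {h : ({c : ι // c ≠ a} → ℝ) → ℝ}

/-- The coordinate `a` of the random vector `V` follows an additive noise model: up to a null set,
it is the function `h` of the other coordinates of `V` plus a noise `Z` independent of them. -/
structure HasAdditiveNoise (μ : Measure Ω) (V : Ω → ι → ℝ) (a : ι)
    (h : ({c : ι // c ≠ a} → ℝ) → ℝ) (Z : Ω → ℝ) : Prop where
  aemeasurable : AEMeasurable V μ
  aemeasurable_noise : AEMeasurable Z μ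
  indepFun : IndepFun Z (fun ω => eraseCoord a (V ω)) μ
  ae_eq : ∀ᵐ ω ∂μ, V ω a = h (eraseCoord a (V ω)) + Z ω

variable [DecidableEq ι]

namespace HasAdditiveNoise

theorem lintegral_comp_eq [IsProbabilityMeasure μ] (hV : HasAdditiveNoise μ V a h Z)
    (hh : Measurable h) {k : (ι → ℝ) → ℝ≥0∞} (hk : Measurable k) :
    ∫⁻ ω, k (V ω) ∂μ = ∫⁻ y, ∫⁻ z, k (insertCoord a (h y + z) y) ∂(μ.map Z)
      ∂(μ.map fun ω => eraseCoord a (V ω)) := by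
  have hY : AEMeasurable (fun ω => eraseCoord a (V ω)) μ :=
    measurable_eraseCoord.comp_aemeasurable hV.aemeasurable
  have := Measure.isProbabilityMeasure_map hV.aemeasurable_noise
  have hkI : Measurable fun q : ({c : ι // c ≠ a} → ℝ) × ℝ =>
      k (insertCoord a (h q.1 + q.2) q.1) := by fun_prop
  rw [← lintegral_prod _ hkI.aemeasurable, ← (indepFun_iff_map_prod_eq_prod_map_map hY
    hV.aemeasurable_noise).1 hV.indepFun.symm, lintegral_map' hkI.aemeasurable
    (hY.prodMk hV.aemeasurable_noise)]
  refine lintegral_congr_ae ?_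
  filter_upwards [hV.ae_eq] with ω hω
  rw [← hω, insertCoord_eraseCoord, Function.update_eq_self]

variable [Fintype ι]

theorem map_eq_withDensity [IsProbabilityMeasure μ] (hV : HasAdditiveNoise μ V a h Z)
    (hh : Measurable h) {m : ({c : ι // c ≠ a} → ℝ) → ℝ≥0∞} {ψ : ℝ → ℝ≥0∞} (hm : Measurable m)
    (hψ : Measurable ψ) (hYlaw : μ.map (fun ω => eraseCoord a (V ω)) = volume.withDensity m)
    (hZlaw : μ.map Z = volume.withDensity ψ) :
    μ.map V = volume.withDensity fun x => m (eraseCoord a x) * ψ (x a - h (eraseCoord a x)) := by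
  have hdens : Measurable fun x => m (eraseCoord a x) * ψ (x a - h (eraseCoord a x)) := by
    fun_prop
  refine Measure.ext_of_lintegral _ fun k hk => ?_
  have htranslate (y : {c : ι // c ≠ a} → ℝ) :
      ∫⁻ z, k (insertCoord a (h y + z) y) ∂(volume.withDensity ψ)
        = ∫⁻ u, ψ (u - h y) * k (insertCoord a u y) := by
    rw [lintegral_withDensity_eq_lintegral_mul _ hψ (by fun_prop),
      ← lintegral_add_left_eq_self (fun u => ψ (u - h y) * k (insertCoord a u y)) (h y)]
    simp only [Pi.mul_apply, add_sub_cancel_left]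
  rw [lintegral_map' hk.aemeasurable hV.aemeasurable, hV.lintegral_comp_eq hh hk, hYlaw, hZlaw,
    lintegral_withDensity_eq_lintegral_mul _ hdens hk,
    lintegral_eq_lintegral_lintegral_insertCoord a (hdens.mul hk)]
  simp only [htranslate]
  rw [lintegral_withDensity_eq_lintegral_mul _ hm (by fun_prop)]
  refine lintegral_congr fun y => ?_
  simp only [Pi.mul_apply, eraseCoord_insertCoord, insertCoord_self, mul_assoc]
  exact (lintegral_const_mul _ (by fun_prop)).symm

theorem ae_ae_density_eq [IsProbabilityMeasure μ] (hV : HasAdditiveNoise μ V a h Z)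
    (hh : Measurable h) {f : (ι → ℝ) → ℝ≥0∞} {ψ : ℝ → ℝ≥0∞} (hf : Measurable f)
    (hψ : Measurable ψ) (hlaw : μ.map V = volume.withDensity f)
    (hZlaw : μ.map Z = volume.withDensity ψ) :
    ∀ᵐ y, ∀ᵐ u, f (insertCoord a u y) = (∫⁻ w, f (insertCoord a w y)) * ψ (u - h y) := by
  set m : ({c : ι // c ≠ a} → ℝ) → ℝ≥0∞ := fun y => ∫⁻ w, f (insertCoord a w y)
  have hm : Measurable m := by fun_prop
  have hYlaw : μ.map (fun ω => eraseCoord a (V ω)) = volume.withDensity m := by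
    rw [← map_eraseCoord_withDensity a hf, ← hlaw, AEMeasurable.map_map_of_aemeasurable
      measurable_eraseCoord.aemeasurable hV.aemeasurable]
    rfl
  have hae := (withDensity_eq_iff_of_sigmaFinite hf.aemeasurable (by fun_prop)).1
    (hlaw.symm.trans (hV.map_eq_withDensity hh hm hψ hYlaw hZlaw))
  simpa using ae_ae_insertCoord_of_ae a hae

/-- Comparing the values of `g` at two points of the same line in the direction `a` eliminates the
marginal density, so that the resulting identity extends from almost all lines to all of them. -/
theorem density_eq_marginalDensity_mul [IsProbabilityMeasure μ]
    (hV : HasAdditiveNoise μ V a h Z) (hh : Continuous h) {g : (ι → ℝ) → ℝ} {φ : ℝ → ℝ}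
    (hg : Continuous g) (hg_nonneg : ∀ x, 0 ≤ g x) (hφ : Continuous φ) (hφ_nonneg : ∀ z, 0 ≤ φ z)
    (hlaw : μ.map V = volume.withDensity fun x => ENNReal.ofReal (g x))
    (hZlaw : μ.map Z = volume.withDensity fun z => ENNReal.ofReal (φ z)) (x : ι → ℝ) :
    g x = marginalDensity g a (eraseCoord a x) * φ (x a - h (eraseCoord a x)) := by
  have hφ_one : ∫ z, φ z = 1 := by
    have := Measure.isProbabilityMeasure_map (μ := μ) hV.aemeasurable_noise
    rw [integral_eq_lintegral_of_nonneg_ae (.of_forall hφ_nonneg) hφ.aestronglyMeasurable,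
      ← setLIntegral_univ, ← withDensity_apply _ .univ, ← hZlaw, measure_univ, ENNReal.toReal_one]
  have hcross (u w : ℝ) : (fun y => g (insertCoord a u y) * φ (w - h y))
      = fun y => g (insertCoord a w y) * φ (u - h y) := by
    refine (Continuous.ae_eq_iff_eq volume (by fun_prop) (by fun_prop)).1 ?_
    filter_upwards [hV.ae_ae_density_eq hh.measurable (by fun_prop) (by fun_prop) hlaw hZlaw]
      with y hy
    have hline : (fun u => g (insertCoord a u y))
        = fun u => (∫⁻ w, ENNReal.ofReal (g (insertCoord a w y))).toReal * φ (u - h y) := by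
      refine (Continuous.ae_eq_iff_eq volume (by fun_prop) (by fun_prop)).1 ?_
      filter_upwards [hy] with u hu
      simpa [hg_nonneg, hφ_nonneg] using congrArg ENNReal.toReal hu
    rw [congrFun hline u, congrFun hline w, mul_right_comm]
  have hint : ∫ w, g (insertCoord a (x a) (eraseCoord a x)) * φ (w - h (eraseCoord a x))
      = ∫ w, g (insertCoord a w (eraseCoord a x)) * φ (x a - h (eraseCoord a x)) :=
    integral_congr_ae (.of_forall fun w => congrFun (hcross (x a) w) (eraseCoord a x))
  rwa [integral_const_mul, integral_mul_const, integral_sub_right_eq_self φ, hφ_one, mul_one,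
    insertCoord_eraseCoord, Function.update_eq_self] at hint

end HasAdditiveNoise

end AdditiveNoise

section Score

variable {ι : Type*} [DecidableEq ι] {a : ι} {g : (ι → ℝ) → ℝ} {φ : ℝ → ℝ}
  {h : ({c : ι // c ≠ a} → ℝ) → ℝ}

theorem marginalDensity_pos (hg_pos : ∀ x, 0 < g x) (hφ_pos : ∀ z, 0 < φ z)
    (hfac : ∀ x, g x = marginalDensity g a (eraseCoord a x) * φ (x a - h (eraseCoord a x)))
    (y : {c : ι // c ≠ a} → ℝ) : 0 < marginalDensity g a y := by
  have hpos := hfac (insertCoord a 0 y) ▸ hg_pos (insertCoord a 0 y)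
  rw [eraseCoord_insertCoord] at hpos
  exact pos_of_mul_pos_left hpos (hφ_pos _).le

variable [Finite ι]

theorem differentiable_marginalDensity (hg : Differentiable ℝ g) (hh : Differentiable ℝ h)
    (hφ0 : φ 0 ≠ 0)
    (hfac : ∀ x, g x = marginalDensity g a (eraseCoord a x) * φ (x a - h (eraseCoord a x))) :
    Differentiable ℝ (marginalDensity g a) := by
  have := Fintype.ofFinite ι
  have heq : marginalDensity g a = fun y => g (insertCoord a (h y) y) / φ 0 := by
    funext y
    rw [hfac, eraseCoord_insertCoord, insertCoord_self, sub_self, mul_div_cancel_right₀ _ hφ0]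
  rw [heq]
  fun_prop

theorem partialScore_eq_sub (hg_pos : ∀ x, 0 < g x) (hg : Differentiable ℝ g)
    (hφ_pos : ∀ z, 0 < φ z) (hφ : Differentiable ℝ φ) (hh : Differentiable ℝ h)
    (hfac : ∀ x, g x = marginalDensity g a (eraseCoord a x) * φ (x a - h (eraseCoord a x)))
    (c : {c : ι // c ≠ a}) (x : ι → ℝ) :
    partialScore g c x = partialScore (marginalDensity g a) c (eraseCoord a x)
      - logDeriv φ (x a - h (eraseCoord a x)) * partialDeriv h c (eraseCoord a x) := by
  have := Fintype.ofFinite ι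
  have hm_pos := marginalDensity_pos hg_pos hφ_pos hfac
  have hm : Differentiable ℝ fun y => Real.log (marginalDensity g a y) :=
    (differentiable_marginalDensity hg hh (hφ_pos 0).ne' hfac).log fun y => (hm_pos y).ne'
  have hlog (u : ℝ) : Real.log (g (Function.update x c u))
      = Real.log (marginalDensity g a (Function.update (eraseCoord a x) c u))
        + Real.log (φ (x a - h (Function.update (eraseCoord a x) c u))) := by
    rw [hfac, eraseCoord_update_coe, Function.update_of_ne c.2.symm,
      Real.log_mul (hm_pos _).ne' (hφ_pos _).ne']
  have hm' := hasDerivAt_partialDeriv c (eraseCoord a x) (eraseCoord a x c) (hm _)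
  have hh' := hasDerivAt_partialDeriv c (eraseCoord a x) (eraseCoord a x c) (hh _)
  have hφ' : HasDerivAt (fun u => Real.log (φ (x a - h (Function.update (eraseCoord a x) c u))))
      (-(logDeriv φ (x a - h (eraseCoord a x)) * partialDeriv h c (eraseCoord a x)))
      (eraseCoord a x c) := by
    refine (((hφ _).hasDerivAt.comp _ (hh'.const_sub (x a))).log (hφ_pos _).ne').congr_deriv ?_
    simp only [Function.update_eq_self, Function.comp_apply, logDeriv_apply]
    ring
  rw [Function.update_eq_self] at hm'
  rw [sub_eq_add_neg, partialScore, partialDeriv]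
  simp only [hlog]
  exact (hm'.add hφ').deriv

end Score

section ScoreVariance

variable {Ω ι : Type*} [MeasurableSpace Ω] {μ : Measure Ω} [DecidableEq ι] [Fintype ι] {a : ι}
  {V : Ω → ι → ℝ} {Z : Ω → ℝ} {h : ({c : ι // c ≠ a} → ℝ) → ℝ} {g : (ι → ℝ) → ℝ}

theorem volume_absolutelyContinuous_of_density_pos {E : Type*} [MeasureSpace E] {ν : Measure E}
    {f : E → ℝ} (hf : AEMeasurable f) (hf_pos : ∀ x, 0 < f x)
    (hν : ν = volume.withDensity fun x => ENNReal.ofReal (f x)) : volume ≪ ν :=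
  hν ▸ withDensity_absolutelyContinuous' hf.ennreal_ofReal
    (.of_forall fun x => (ENNReal.ofReal_pos.2 (hf_pos x)).ne')

theorem partialDeriv_eq_zero_of_comp_eraseCoord_ae_eq_zero (hV : AEMeasurable V μ)
    (hac : volume ≪ μ.map V) (hh : Differentiable ℝ h) {c : {c : ι // c ≠ a}}
    (h0 : (fun ω => partialDeriv h c (eraseCoord a (V ω))) =ᵐ[μ] 0)
    (y : {c : ι // c ≠ a} → ℝ) : partialDeriv h c y = 0 := by
  have hmeas : Measurable fun x : ι → ℝ => partialDeriv h c (eraseCoord a x) :=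
    (measurable_partialDeriv hh c).comp measurable_eraseCoord
  have hx : ∀ᵐ x : ι → ℝ, partialDeriv h c (eraseCoord a x) = 0 :=
    hac.ae_le ((ae_map_iff hV (hmeas (measurableSet_singleton 0))).2 h0)
  exact partialDeriv_eq_zero_of_ae hh (by simpa using ae_ae_insertCoord_of_ae a hx) y

namespace HasAdditiveNoise

variable [IsProbabilityMeasure μ]

theorem evariance_partialScore_marginalDensity_lt_iff (hV : HasAdditiveNoise μ V a h Z)
    (hh : Differentiable ℝ h) (hg_pos : ∀ x, 0 < g x) (hg : Differentiable ℝ g)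
    (hlaw : μ.map V = volume.withDensity fun x => ENNReal.ofReal (g x))
    {φ : ℝ → ℝ} (hφ_pos : ∀ z, 0 < φ z) (hφ : Differentiable ℝ φ)
    (hZlaw : μ.map Z = volume.withDensity fun z => ENNReal.ofReal (φ z))
    (hmean : ∫ ω, logDeriv φ (Z ω) ∂μ = 0) (hne : ¬ (fun ω => logDeriv φ (Z ω)) =ᵐ[μ] 0)
    (c : {c : ι // c ≠ a})
    (hfin : evariance (fun ω => partialScore (marginalDensity g a) c (eraseCoord a (V ω))) μ < ∞) :
    evariance (fun ω => partialScore (marginalDensity g a) c (eraseCoord a (V ω))) μ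
        < evariance (fun ω => partialScore g c (V ω)) μ
      ↔ ∃ y, partialDeriv h c y ≠ 0 := by
  have hfac := hV.density_eq_marginalDensity_mul hh.continuous hg.continuous
    (fun x => (hg_pos x).le) hφ.continuous (fun z => (hφ_pos z).le) hlaw hZlaw
  have hm : Differentiable ℝ fun y => Real.log (marginalDensity g a y) :=
    (differentiable_marginalDensity hg hh (hφ_pos 0).ne' hfac).log
      fun y => (marginalDensity_pos hg_pos hφ_pos hfac y).ne'
  have hY : AEMeasurable (fun ω => eraseCoord a (V ω)) μ :=
    measurable_eraseCoord.comp_aemeasurable hV.aemeasurable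
  have hA := measurable_partialDeriv hm c
  have hB := measurable_partialDeriv hh c
  have hS : Measurable (logDeriv φ) := (measurable_deriv φ).div hφ.continuous.measurable
  have hscore : (fun ω => partialScore g c (V ω)) =ᵐ[μ]
      (fun ω => partialScore (marginalDensity g a) c (eraseCoord a (V ω)))
        - (fun ω => logDeriv φ (Z ω)) * fun ω => partialDeriv h c (eraseCoord a (V ω)) := by
    filter_upwards [hV.ae_eq] with ω hω
    rw [partialScore_eq_sub hg_pos hg hφ_pos hφ hh hfac, hω, add_sub_cancel_left]
    rfl
  rw [evariance_congr hscore]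
  constructor
  · contrapose!
    intro h0
    simp only [h0]
    exact (congrArg (evariance · μ) (by ext ω; simp)).le
  · rintro ⟨y, hy⟩
    refine evariance_lt_evariance_sub_mul_of_indepFun
      ((evariance_lt_top_iff_memLp (hA.comp_aemeasurable hY).aestronglyMeasurable).1 hfin)
      (hB.comp_aemeasurable hY) (hS.comp_aemeasurable hV.aemeasurable_noise) (fun h0 => hy ?_)
      hne hmean (hV.indepFun.comp hS (hA.prodMk hB))
    exact partialDeriv_eq_zero_of_comp_eraseCoord_ae_eq_zero hV.aemeasurable
      (volume_absolutelyContinuous_of_density_pos hg.continuous.aemeasurable hg_pos hlaw) hh h0 y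

end HasAdditiveNoise

end ScoreVariance

section Gaussian

theorem hasDerivAt_gaussianPDFReal (m : ℝ) (v : ℝ≥0) (z : ℝ) :
    HasDerivAt (gaussianPDFReal m v) (gaussianPDFReal m v z * (-(z - m) / v)) z := by
  have hexp := (((((hasDerivAt_id z).sub_const m).pow 2).neg.div_const (2 * (v : ℝ))).exp).const_mul
    (√(2 * Real.pi * v))⁻¹
  refine hexp.congr_deriv ?_
  simp only [gaussianPDFReal, Pi.neg_apply, Pi.pow_apply, id_eq, Nat.cast_ofNat]
  ring

theorem differentiable_gaussianPDFReal (m : ℝ) (v : ℝ≥0) : Differentiable ℝ (gaussianPDFReal m v) :=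
  fun z => (hasDerivAt_gaussianPDFReal m v z).differentiableAt

theorem logDeriv_gaussianPDFReal (m : ℝ) {v : ℝ≥0} (hv : v ≠ 0) (z : ℝ) :
    logDeriv (gaussianPDFReal m v) z = -(z - m) / v := by
  rw [logDeriv_apply, (hasDerivAt_gaussianPDFReal m v z).deriv,
    mul_div_cancel_left₀ _ (gaussianPDFReal_pos m v z hv).ne']

theorem integral_logDeriv_gaussianPDFReal (m : ℝ) {v : ℝ≥0} (hv : v ≠ 0) :
    ∫ z, logDeriv (gaussianPDFReal m v) z ∂gaussianReal m v = 0 := by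
  have hid : Integrable (fun z : ℝ => z) (gaussianReal m v) :=
    (memLp_id_gaussianReal 1).integrable le_rfl
  simp only [logDeriv_gaussianPDFReal m hv]
  rw [integral_div, integral_neg, integral_sub hid (integrable_const m), integral_id_gaussianReal]
  simp

theorem not_logDeriv_gaussianPDFReal_ae_eq_zero (m : ℝ) {v : ℝ≥0} (hv : v ≠ 0) :
    ¬ logDeriv (gaussianPDFReal m v) =ᵐ[gaussianReal m v] 0 := by
  have := nullSingletonClass_gaussianReal (μ := m) hv
  intro h0
  obtain ⟨z, hz, hzm⟩ := (h0.and (Measure.ae_ne (gaussianReal m v) m)).exists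
  exact hzm (by simpa [logDeriv_gaussianPDFReal m hv, sub_eq_zero, hv, eq_comm] using hz)

variable {Ω ι : Type*} [MeasurableSpace Ω] {μ : Measure Ω} [DecidableEq ι] {a : ι}
  {V : Ω → ι → ℝ} {Z : Ω → ℝ} {h : ({c : ι // c ≠ a} → ℝ) → ℝ} {g : (ι → ℝ) → ℝ}

/-- The logarithm of the Gaussian density is quadratic, so the increment of `log g` along a line
in the direction `a` determines `h`. -/
theorem differentiable_of_density_eq_mul_gaussianPDFReal [Finite ι] {m : ℝ} {v : ℝ≥0}
    (hv : v ≠ 0) (hg_pos : ∀ x, 0 < g x) (hg : Differentiable ℝ g)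
    (hfac : ∀ x, g x = marginalDensity g a (eraseCoord a x)
      * gaussianPDFReal m v (x a - h (eraseCoord a x))) : Differentiable ℝ h := by
  have := Fintype.ofFinite ι
  have hφ_pos (z : ℝ) : 0 < gaussianPDFReal m v z := gaussianPDFReal_pos m v z hv
  have hv0 : (v : ℝ) ≠ 0 := by exact_mod_cast hv
  have heq : h = fun y => v * (Real.log (g (insertCoord a 1 y)) - Real.log (g (insertCoord a 0 y)))
      + (1 / 2 - m) := by
    funext y
    have hm_pos := marginalDensity_pos hg_pos hφ_pos hfac y
    rw [hfac (insertCoord a 1 y), hfac (insertCoord a 0 y)]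
    simp only [eraseCoord_insertCoord, insertCoord_self]
    rw [Real.log_mul hm_pos.ne' (hφ_pos _).ne', Real.log_mul hm_pos.ne' (hφ_pos _).ne']
    have hc : (√(2 * Real.pi * v))⁻¹ ≠ 0 := left_ne_zero_of_mul (hφ_pos 0).ne'
    simp only [gaussianPDFReal, Real.log_mul hc (Real.exp_ne_zero _), Real.log_exp]
    field_simp
    ring
  have hlog (u : ℝ) : Differentiable ℝ fun y => Real.log (g (insertCoord a u y)) :=
    Differentiable.log (by fun_prop) fun y => (hg_pos _).ne'
  rw [heq]
  exact (((hlog 1).sub (hlog 0)).const_mul _).add_const _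

theorem HasAdditiveNoise.evariance_partialScore_marginalDensity_lt_iff_of_gaussianReal [Fintype ι]
    [IsProbabilityMeasure μ] (hV : HasAdditiveNoise μ V a h Z) (hh : Continuous h)
    (hg_pos : ∀ x, 0 < g x) (hg : Differentiable ℝ g)
    (hlaw : μ.map V = volume.withDensity fun x => ENNReal.ofReal (g x))
    {m : ℝ} {v : ℝ≥0} (hv : v ≠ 0) (hZ : μ.map Z = gaussianReal m v) (c : {c : ι // c ≠ a})
    (hfin : evariance (fun ω => partialScore (marginalDensity g a) c (eraseCoord a (V ω))) μ < ∞) :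
    evariance (fun ω => partialScore (marginalDensity g a) c (eraseCoord a (V ω))) μ
        < evariance (fun ω => partialScore g c (V ω)) μ
      ↔ ∃ y, partialDeriv h c y ≠ 0 := by
  have hφ_pos (z : ℝ) : 0 < gaussianPDFReal m v z := gaussianPDFReal_pos m v z hv
  have hφ := differentiable_gaussianPDFReal m v
  have hS : Measurable (logDeriv (gaussianPDFReal m v)) :=
    (measurable_deriv _).div hφ.continuous.measurable
  have hZlaw := hZ.trans (gaussianReal_of_var_ne_zero m hv)
  have hhd := differentiable_of_density_eq_mul_gaussianPDFReal hv hg_pos hg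
    (hV.density_eq_marginalDensity_mul hh hg.continuous (fun x => (hg_pos x).le)
      hφ.continuous (fun z => (hφ_pos z).le) hlaw hZlaw)
  refine hV.evariance_partialScore_marginalDensity_lt_iff hhd hg_pos hg hlaw hφ_pos hφ hZlaw
    ?_ ?_ c hfin
  · rw [← integral_logDeriv_gaussianPDFReal m hv, ← hZ,
      integral_map hV.aemeasurable_noise hS.aestronglyMeasurable]
  · intro h0
    refine not_logDeriv_gaussianPDFReal_ae_eq_zero m hv ?_
    rw [← hZ]
    exact (ae_map_iff hV.aemeasurable_noise (hS (measurableSet_singleton 0))).2 h0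

end Gaussian

namespace SVARModel

variable {d p : ℕ} {M : SVARModel d p}

theorem wellFounded_mem_pa (M : SVARModel d p) :
    WellFounded fun i j : Fin d => ((0, i) : LagNode d p) ∈ M.pa j := by
  have : Std.Irrefl (Relation.TransGen fun i j : Fin d => ((0, i) : LagNode d p) ∈ M.pa j) :=
    ⟨M.acyclic⟩
  exact Subrelation.wf (fun h => Relation.TransGen.single h)
    (Finite.wellFounded_of_trans_of_irrefl
      (Relation.TransGen fun i j : Fin d => ((0, i) : LagNode d p) ∈ M.pa j))

theorem wellFounded_parents_of_present (M : SVARModel d p) :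
    WellFounded fun c c' : LagNode d p => c'.1 = 0 ∧ c ∈ M.pa c'.2 := by
  have hlagged (c : LagNode d p) (hc : c.1 ≠ 0) :
      Acc (fun c c' : LagNode d p => c'.1 = 0 ∧ c ∈ M.pa c'.2) c :=
    ⟨_, fun _ h => (hc h.1).elim⟩
  have hpresent (j : Fin d) :
      Acc (fun c c' : LagNode d p => c'.1 = 0 ∧ c ∈ M.pa c'.2) (0, j) := by
    induction j using M.wellFounded_mem_pa.induction with
    | _ j ih =>
      refine ⟨_, fun ⟨k, i⟩ h => ?_⟩
      by_cases hk : k = 0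
      · subst hk
        exact ih i h.2
      · exact hlagged _ hk
  refine ⟨fun ⟨k, j⟩ => ?_⟩
  by_cases hk : k = 0
  · exact hk ▸ hpresent j
  · exact hlagged _ hk

theorem ne_of_mem_pa {l : Fin d} {c : LagNode d p} (hc : c ∈ M.pa l) : c ≠ (0, l) := by
  rintro rfl
  exact M.acyclic l (.single hc)

/-- The link function of the feature `l`, regarded as a function of all the variables other than
`l` itself at the present time: it only depends on those that are parents of `l`. -/
def extendedLink (M : SVARModel d p) (l : Fin d) (y : {c : LagNode d p // c ≠ (0, l)} → ℝ) : ℝ :=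
  M.link l fun c => y ⟨c, ne_of_mem_pa c.2⟩

theorem exists_partialDeriv_extendedLink_ne_zero_iff {l : Fin d}
    (hlink : ∀ c : M.pa l, ∃ x, partialDeriv (M.link l) c x ≠ 0)
    (c : {c : LagNode d p // c ≠ (0, l)}) :
    (∃ y, partialDeriv (M.extendedLink l) c y ≠ 0) ↔ (c : LagNode d p) ∈ M.pa l := by
  let e : M.pa l → {c : LagNode d p // c ≠ (0, l)} := fun b => ⟨b, ne_of_mem_pa b.2⟩
  have he : e.Injective := fun b b' h => Subtype.ext (Subtype.mk.inj h)
  constructor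
  · contrapose!
    exact fun hc => partialDeriv_comp_of_notMem_range (M.link l) (e := e)
      fun ⟨b, hb⟩ => hc (hb ▸ b.2)
  · intro hc
    obtain ⟨x, hx⟩ := hlink ⟨c, hc⟩
    refine ⟨Function.extend e x 0, ?_⟩
    rwa [← Function.extend_comp he x 0,
      ← partialDeriv_comp_of_injective (M.link l) he ⟨c, hc⟩] at hx

/-- All the randomness that enters the process up to time `t`, except for the noise of the feature
`l` at time `t`: the noise of the other features at time `t`, and the snapshots before time `t`. -/
def exogenousWithout {Ω : Type*} (X z : ℕ → Fin d → Ω → ℝ) (t : ℕ) (l : Fin d) (ω : Ω) :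
    ({i : Fin d // i ≠ l} → ℝ) × (Set.Ico 1 t → Fin d → ℝ) :=
  (fun i => z t i ω, fun r i => X r i ω)

namespace Generates

variable {Ω : Type*} [MeasurableSpace Ω] {μ : Measure Ω} {T t : ℕ} {X z : ℕ → Fin d → Ω → ℝ}
  {l : Fin d}

theorem measurable_stackedVector (hX : M.Generates T μ X z) (hpt : p < t) (htT : t ≤ T) :
    Measurable (stackedVector p X t) :=
  measurable_pi_lambda _ fun c => hX.measurable_process _ ⟨by omega, by omega⟩ _

theorem indepFun_noise_exogenousWithout [IsProbabilityMeasure μ] (hX : M.Generates T μ X z)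
    (ht : t ∈ Set.Ioc p T) (l : Fin d) :
    IndepFun (z t l) (exogenousWithout X z t l) μ := by
  have hz : ∀ i, Measurable (z t i) := hX.measurable_noise t ht
  have hpast : Measurable fun ω (r : Set.Ico 1 t) (i : Fin d) => X r i ω :=
    measurable_pi_lambda _ fun r => measurable_pi_lambda _ fun i =>
      hX.measurable_process r ⟨r.2.1, r.2.2.le.trans ht.2⟩ i
  have hothers : IndepFun (z t l) (fun ω (i : {i : Fin d // i ≠ l}) => z t i ω) μ :=
    ((hX.noise_indep t ht).indepFun_finset {l} {l}ᶜ disjoint_compl_right hz).comp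
      (φ := fun x : ({l} : Finset (Fin d)) → ℝ => x ⟨l, Finset.mem_singleton_self l⟩)
      (ψ := fun (x : ({l}ᶜ : Finset (Fin d)) → ℝ) (i : {i : Fin d // i ≠ l}) =>
        x ⟨i, by simpa using i.2⟩)
      (by fun_prop) (by fun_prop)
  have hnoise_past : IndepFun (fun ω => (z t l ω, fun i : {i : Fin d // i ≠ l} => z t i ω))
      (fun ω (r : Set.Ico 1 t) (i : Fin d) => X r i ω) μ :=
    (hX.noise_indep_past t ht).comp
      (φ := fun w : Fin d → ℝ => (w l, fun i : {i : Fin d // i ≠ l} => w i)) (by fun_prop)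
      measurable_id
  have hothers_meas : Measurable fun ω (i : {i : Fin d // i ≠ l}) => z t i ω :=
    measurable_pi_lambda _ fun i => hz i
  exact indepFun_prodMk_right_of_prodMk_left (hz l).aemeasurable hothers_meas.aemeasurable
    hpast.aemeasurable hothers hnoise_past

theorem exists_ae_eq_comp_exogenousWithout (hX : M.Generates T μ X z)
    (hlink : ∀ j ≠ l, Measurable (M.link j)) (ht : t ∈ Set.Ioc p T) (hl : M.IsLeaf l)
    (c : LagNode d p) (hc : c ≠ (0, l)) :
    ∃ F, Measurable F ∧
      ∀ᵐ ω ∂μ, stackedVector p X t ω c = F (exogenousWithout X z t l ω) := by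
  induction c using M.wellFounded_parents_of_present.induction with
  | _ c ih =>
    obtain ⟨k, j⟩ := c
    by_cases hk : k = 0
    · subst hk
      have hj : j ≠ l := fun hjl => hc (hjl ▸ rfl)
      have hparents (c : M.pa j) := ih c ⟨rfl, c.2⟩ fun hcl => hl j (hcl ▸ c.2)
      choose F hF hFeq using hparents
      have := hlink j hj
      refine ⟨fun w => M.link j (fun c => F c w) + w.1 ⟨j, hj⟩, by fun_prop, ?_⟩
      filter_upwards [hX.equation t ht, ae_all_iff.2 hFeq] with ω hω hFω
      simp only [← hFω]
      exact hω j
    · have hk0 : (k : ℕ) ≠ 0 := fun h => hk (Fin.ext h)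
      have hpt := ht.1
      exact ⟨fun w => w.2 ⟨t - k, by omega, by omega⟩ j, by fun_prop, .of_forall fun _ => rfl⟩

theorem indepFun_noise_stackedVectorWithout [IsProbabilityMeasure μ] (hX : M.Generates T μ X z)
    (hlink : ∀ j ≠ l, Measurable (M.link j)) (ht : t ∈ Set.Ioc p T) (hl : M.IsLeaf l) :
    IndepFun (z t l) (stackedVectorWithout p X t l) μ := by
  have hnodes (c : {c : LagNode d p // c ≠ (0, l)}) :=
    hX.exists_ae_eq_comp_exogenousWithout hlink ht hl c c.2
  choose F hF hFeq using hnodes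
  refine ((hX.indepFun_noise_exogenousWithout ht l).comp measurable_id
    (measurable_pi_lambda (fun w c => F c w) hF)).congr .rfl ?_
  filter_upwards [ae_all_iff.2 hFeq] with ω hω
  exact funext fun c => (hω c).symm

theorem hasAdditiveNoise [IsProbabilityMeasure μ] (hX : M.Generates T μ X z)
    (hlink : ∀ j ≠ l, Measurable (M.link j)) (ht : t ∈ Set.Ioc p T) (hl : M.IsLeaf l) :
    HasAdditiveNoise μ (stackedVector p X t) (0, l) (M.extendedLink l) (z t l) where
  aemeasurable := (hX.measurable_stackedVector ht.1 ht.2).aemeasurable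
  aemeasurable_noise := (hX.measurable_noise t ht l).aemeasurable
  indepFun := hX.indepFun_noise_stackedVectorWithout hlink ht hl
  ae_eq := (hX.equation t ht).mono fun _ hω => hω l

end Generates

end SVARModel

theorem mainTheorem1_general {Ω : Type*} [MeasurableSpace Ω] (μ : Measure Ω)
    [IsProbabilityMeasure μ] {d p : ℕ} (M : SVARModel d p)
    (T : ℕ) (X z : ℕ → Fin d → Ω → ℝ) (hX : M.Generates T μ X z)
    (t : ℕ) (hpt : p < t) (htT : t ≤ T)
    (g : (LagNode d p → ℝ) → ℝ)
    (hg_law : μ.map (stackedVector p X t) = volume.withDensity (fun x => ENNReal.ofReal (g x)))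
    (hg_pos : ∀ x, 0 < g x) (hg_diff : Differentiable ℝ g)
    (l : Fin d) (hl : M.IsLeaf l)
    (hlink_meas : ∀ j ≠ l, Measurable (M.link j)) (hlink_cont : Continuous (M.link l))
    (hlink : ∀ c : M.pa l, ∃ x, partialDeriv (M.link l) c x ≠ 0)
    (k : Fin (p + 1)) (j : Fin d) (hkj : ((k, j) : LagNode d p) ≠ (0, l))
    (hfin : evariance (fun ω => partialScore (marginalDensity g (0, l)) ⟨(k, j), hkj⟩
      (stackedVectorWithout p X t l ω)) μ < ∞) :
    (k, j) ∈ M.pa l ↔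
      evariance (fun ω => partialScore g (k, j) (stackedVector p X t ω)) μ >
        evariance (fun ω => partialScore (marginalDensity g (0, l)) ⟨(k, j), hkj⟩
          (stackedVectorWithout p X t l ω)) μ := by
  have hnoise := hX.hasAdditiveNoise hlink_meas ⟨hpt, htT⟩ hl
  have hcont : Continuous (M.extendedLink l) := hlink_cont.comp (by fun_prop)
  have hvar := hnoise.evariance_partialScore_marginalDensity_lt_iff_of_gaussianReal hcont hg_pos
    hg_diff hg_law (M.noiseVar_pos l).ne' (hX.noise_law t ⟨hpt, htT⟩ l) ⟨(k, j), hkj⟩ hfin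
  exact (M.exists_partialDeriv_extendedLink_ne_zero_iff hlink ⟨(k, j), hkj⟩).symm.trans hvar.symm

theorem mainTheorem1 {Ω : Type*} [MeasurableSpace Ω] (μ : Measure Ω) [IsProbabilityMeasure μ]
    {d p : ℕ} (M : SVARModel d p) (hM : M.RegularLinks)
    (T : ℕ) (X z : ℕ → Fin d → Ω → ℝ) (hX : M.Generates T μ X z)
    (t : ℕ) (hpt : p < t) (htT : t ≤ T)
    -- the joint density of the vector (X^{(t)}, …, X^{(t-p)})
    (g : (LagNode d p → ℝ) → ℝ)
    (hg_law : μ.map (stackedVector p X t) = volume.withDensity (fun x => ENNReal.ofReal (g x)))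
    (hg_pos : ∀ x, 0 < g x) (hg_diff : Differentiable ℝ g)
    (l : Fin d) (hl : M.IsLeaf l)
    (k : Fin (p + 1)) (j : Fin d) (hkj : ((k, j) : LagNode d p) ≠ (0, l))
    -- after the removal of l, the partial score has a finite variance
    (hfin : evariance (fun ω => partialScore (marginalDensity g (0, l)) ⟨(k, j), hkj⟩
      (stackedVectorWithout p X t l ω)) μ < ∞) :
    (k, j) ∈ M.pa l ↔
      evariance (fun ω => partialScore g (k, j) (stackedVector p X t ω)) μ >
        evariance (fun ω => partialScore (marginalDensity g (0, l)) ⟨(k, j), hkj⟩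
          (stackedVectorWithout p X t l ω)) μ := by
  exact mainTheorem1_general μ M T X z hX t hpt htT g hg_law hg_pos hg_diff l hl
    (fun i _ => (hM.smooth i).continuous.measurable) (hM.smooth l).continuous
    (hM.partialDeriv_ne_zero l) k j hkj hfin
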